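/- For a positive integer $Q$ let $\mathfrak F_Q$ be the Farey sequence of order $Q$, that is, the increasing sequence of all reduced fractions in $[0,1]$ with positive denominator at most $Q$. For integers $r\ge 1$, $d\ge 2$ and $\mathbf c=(c_1,\dots,c_r)$ with $0\le c_j\le d-1$, let $N_Q^r(\mathbf c;d)$ be the number of $r$-tuples $(a_1/q_1,\dots,a_r/q_r)$ of consecutive elements of $\mathfrak F_Q$ such that $q_j\equiv c_j \pmod d$ for $1\le j\le r$, and put $$\rho_Q^r(\mathbf c;d)=\frac{N_Q^r(\mathbf c;d)}{\#\mathfrak F_Q-(r-1)},\qquad \rho^r(\mathbf c;d)=\lim_{Q\to\infty}\rho_Q^r(\mathbf c;d)$$ whenever this limit exists. Let $r\ge 5$, $d\ge 2$ and $0\le c\le d-1$ be integers with $\gcd(c,d)=1$. Then the limit $\rho^r(c,\dots,c;d)$ exists and $$\rho^r(c,\dots,c;d)=\frac{1}{d^2(2r-3)}\prod_{p\mid d}\Big(1-\frac1{p^2}\Big)^{-1},$$ where the product is over the primes $p$ dividing $d$. In particular, for every $r\ge 5$ the limiting proportion of $r$-tuples of consecutive Farey fractions all of whose denominators are odd is $$\rho^r(1,\dots,1;2)=\frac{1}{3(2r-3)}.$$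 -/

import Mathlib

open Filter Topology

/-- The Farey fractions of order `Q`: the rationals in `[0, 1]` whose (reduced) denominator is
at most `Q`. -/
def fareySet (Q : ℕ) : Set ℚ := {x | 0 ≤ x ∧ x ≤ 1 ∧ x.den ≤ Q}

theorem fareySet_finite (Q : ℕ) : (fareySet Q).Finite := by
  have h : (((Finset.range (Q + 1)) ×ˢ (Finset.range (Q + 1))).image
      (fun p : ℕ × ℕ => (p.1 : ℚ) / (p.2 : ℚ)) : Set ℚ).Finite := Finset.finite_toSet _
  refine h.subset ?_
  rintro x ⟨h0, h1, hQ⟩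
  have hn : 0 ≤ x.num := Rat.num_nonneg.mpr h0
  have hle : x.num ≤ x.den := Rat.num_le_denom_iff.mpr h1
  simp only [Finset.coe_image, Set.mem_image, Finset.mem_coe, Finset.mem_product,
    Finset.mem_range]
  refine ⟨(x.num.toNat, x.den), ⟨by dsimp only; omega, by dsimp only; omega⟩, ?_⟩
  have hc : ((x.num.toNat : ℕ) : ℚ) = (x.num : ℚ) := by
    exact_mod_cast Int.toNat_of_nonneg hn
  dsimp only
  rw [hc, Rat.num_div_den]

/-- `f = (f 0, …, f (r - 1))` is an `r`-tuple of consecutive Farey fractions of order `Q`: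
all entries are Farey fractions of order `Q`, and each entry is the immediate successor of the
preceding one in the increasing enumeration of `fareySet Q`. -/
def IsConsecutiveFarey (Q : ℕ) {r : ℕ} (f : Fin r → ℚ) : Prop :=
  (∀ j, f j ∈ fareySet Q) ∧
    ∀ i j : Fin r, (j : ℕ) = (i : ℕ) + 1 →
      f i < f j ∧ ∀ x ∈ fareySet Q, ¬ (f i < x ∧ x < f j)

/-- The `r`-tuples of consecutive Farey fractions of order `Q` of parity `c` modulo `d`: the
denominator of the `j`-th entry is congruent to `c j` modulo `d`, for every `j`. -/
def fareyTuples (Q : ℕ) {r : ℕ} (c : Fin r → ℕ) (d : ℕ) : Set (Fin r → ℚ) :=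
  {f | IsConsecutiveFarey Q f ∧ ∀ j, (f j).den ≡ c j [MOD d]}

theorem fareyTuples_finite (Q : ℕ) {r : ℕ} (c : Fin r → ℕ) (d : ℕ) :
    (fareyTuples Q c d).Finite :=
  (Set.Finite.pi' fun _ : Fin r => fareySet_finite Q).subset fun _ hf => hf.1.1

/-- The proportion, among all `#F_Q - (r - 1)` tuples of `r` consecutive Farey fractions of
order `Q`, of those that have parity `c` modulo `d`. -/
noncomputable def fareyProportion (Q : ℕ) {r : ℕ} (c : Fin r → ℕ) (d : ℕ) : ℝ :=
  ((fareyTuples Q c d).ncard : ℝ) / (((fareySet Q).ncard : ℝ) - ((r : ℝ) - 1))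

/-! If `q, q', q''` are denominators of consecutive Farey fractions, then `q + q'' = k q'` for an
integer `k`, the index. When all three are congruent to a unit `c` modulo `d`, this forces `d ∣ k -
2`, so `k ≥ 2` and `k ≠ 3`. Neighbouring denominators are at most `Q` and sum to more than `Q`; two
adjacent indices that are at least 2 are then at most 4, hence 2 or 4, and three adjacent ones must
all equal 2 (`index_eq_two`). So for `r ≥ 5` the denominators form an arithmetic progression
(`den_arithmetic`), with difference `± d j`.

Conversely, a progression with coprime first term and difference whose terms are at most `Q` and
whose neighbouring terms sum to more than `Q` comes from exactly one tuple. With `x` the smallest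
term, the conditions read `Q < 2x + dj`, `x + (r-1)dj ≤ Q`, `gcd(j, x) = 1`, `x ≡ c`; each point
`(j, x)` gives one increasing and one decreasing tuple (`ncard_fareyTuples`).

What remains is to count coprime points of a dilated triangle in a residue class
(`WedgeShape.tendsto_card_wedge_coprime`): the area, divided by `d`, times the sum of `μ(n)/n²` over
`n` coprime to `d`. The Farey sequence itself is the case `d = 1` for the triangle `j < x ≤ Q`, and
in the quotient `ζ(2)` cancels, leaving the Euler factors at `p ∣ d`. -/

/-! ### The Möbius sum and its Euler factors. -/

/-- The sum of `μ n / n ^ 2` over the `n` coprime to `d`. -/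
noncomputable def moebiusSum (d : ℕ) : ℝ :=
  ∑' n : ℕ, if n.Coprime d then (ArithmeticFunction.moebius n : ℝ) / (n : ℝ) ^ 2 else 0

theorem moebiusSum_eq_LSeries (d : ℕ) :
    (moebiusSum d : ℂ) = LSeries ((fun n : ℕ => (1 : DirichletCharacter ℂ d) n) *
      fun n : ℕ => ((ArithmeticFunction.moebius n : ℤ) : ℂ)) 2 := by
  rw [moebiusSum, LSeries, Complex.ofReal_tsum]
  refine tsum_congr fun n => ?_
  rcases eq_or_ne n 0 with rfl | hn
  · simp
  rw [LSeries.term_of_ne_zero hn]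
  split_ifs with h
  · have : (1 : DirichletCharacter ℂ d) (n : ZMod d) = 1 :=
      MulChar.one_apply ((ZMod.isUnit_iff_coprime n d).2 h)
    simp [this]
  · have : (1 : DirichletCharacter ℂ d) (n : ZMod d) = 0 :=
      MulChar.map_nonunit _ (fun hu => h ((ZMod.isUnit_iff_coprime n d).1 hu))
    simp [this]

/-- The twist of `μ` by the trivial character modulo `d` is the Dirichlet inverse of that character,
whose L-function is `ζ` without the Euler factors at `p ∣ d`. -/
theorem moebiusSum_mul_prod (d : ℕ) [NeZero d] :
    (moebiusSum d : ℂ) * ((∏ p ∈ d.primeFactors, (1 - 1 / (p : ℝ) ^ 2) : ℝ) : ℂ) *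
      riemannZeta 2 = 1 := by
  have h2 : (1 : ℝ) < (2 : ℂ).re := by norm_num
  have h := DirichletCharacter.LSeries.mul_mu_eq_one (1 : DirichletCharacter ℂ d) h2
  rw [← moebiusSum_eq_LSeries, ← DirichletCharacter.LFunction_eq_LSeries _ h2] at h
  have h3 := DirichletCharacter.LFunctionTrivChar_eq_mul_riemannZeta (N := d) (s := 2)
    (by norm_num)
  rw [DirichletCharacter.LFunctionTrivChar] at h3
  rw [h3] at h
  rw [← h]
  have : ((∏ p ∈ d.primeFactors, (1 - 1 / (p : ℝ) ^ 2) : ℝ) : ℂ) =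
      ∏ p ∈ d.primeFactors, (1 - (p : ℂ) ^ (-2 : ℂ)) := by
    push_cast
    refine Finset.prod_congr rfl fun p _ => ?_
    rw [Complex.cpow_neg]
    simp
  rw [this]
  ring

theorem moebiusSum_one_ne_zero : moebiusSum 1 ≠ 0 := by
  intro h
  have := moebiusSum_mul_prod 1
  simp [h] at this

theorem moebiusSum_div_moebiusSum_one (d : ℕ) [NeZero d] :
    moebiusSum d / moebiusSum 1 = ∏ p ∈ d.primeFactors, (1 - 1 / (p : ℝ) ^ 2)⁻¹ := by
  have h1 := moebiusSum_mul_prod 1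
  have hd := moebiusSum_mul_prod d
  have hz : riemannZeta 2 ≠ 0 := riemannZeta_ne_zero_of_one_lt_re (by norm_num)
  have h : moebiusSum d * ∏ p ∈ d.primeFactors, (1 - 1 / (p : ℝ) ^ 2) = moebiusSum 1 := by
    have := hd.trans h1.symm
    simp only [Nat.primeFactors_one, Finset.prod_empty, Complex.ofReal_one, mul_one] at this
    exact_mod_cast mul_right_cancel₀ hz this
  have hp : ∏ p ∈ d.primeFactors, (1 - 1 / (p : ℝ) ^ 2) ≠ 0 := by
    intro h0
    rw [h0, mul_zero] at h
    exact moebiusSum_one_ne_zero h.symm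
  rw [Finset.prod_inv_distrib, div_eq_iff moebiusSum_one_ne_zero, ← h]
  field_simp

/-! ### Lattice points of a triangle in a residue class. -/

/-- The count is a difference of two floors, which costs at most 1; rounding the endpoints costs at
most `1 / d ≤ 1` more. -/
theorem abs_card_Ioc_filter_modEq_sub_le {A B : ℝ} (hA : 0 ≤ A) (hAB : A ≤ B) {d : ℕ}
    (hd : 0 < d) (c : ℕ) :
    |(((Finset.Ioc ⌊A⌋₊ ⌊B⌋₊).filter (fun x => x ≡ c [MOD d])).card : ℝ) - (B - A) / d| ≤ 2 := by
  have h := Nat.Ioc_filter_modEq_card ⌊A⌋₊ ⌊B⌋₊ hd c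
  have hB : 0 ≤ B := hA.trans hAB
  have hfl : ⌊A⌋₊ ≤ ⌊B⌋₊ := Nat.floor_mono hAB
  have hdq : (0 : ℚ) < d := by exact_mod_cast hd
  have hdr : (1 : ℝ) ≤ d := by exact_mod_cast hd
  have hm : ⌊((⌊A⌋₊ : ℚ) - c) / (d : ℚ)⌋ ≤ ⌊((⌊B⌋₊ : ℚ) - c) / (d : ℚ)⌋ := by
    apply Int.floor_mono
    gcongr
  rw [max_eq_left (by omega)] at h
  have h' : (((Finset.Ioc ⌊A⌋₊ ⌊B⌋₊).filter (fun x => x ≡ c [MOD d])).card : ℝ) =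
      (⌊((⌊B⌋₊ : ℚ) - c) / (d : ℚ)⌋ : ℝ) - (⌊((⌊A⌋₊ : ℚ) - c) / (d : ℚ)⌋ : ℝ) := by
    exact_mod_cast congrArg (Int.cast : ℤ → ℝ) h
  have e1 : ∀ n : ℕ, (⌊((n : ℚ) - c) / (d : ℚ)⌋ : ℝ) ≤ ((n : ℝ) - c) / d ∧
      ((n : ℝ) - c) / d - 1 < (⌊((n : ℚ) - c) / (d : ℚ)⌋ : ℝ) := by
    intro n
    have a := Int.floor_le (((n : ℚ) - c) / (d : ℚ))
    have b := Int.sub_one_lt_floor (((n : ℚ) - c) / (d : ℚ))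
    constructor
    · exact_mod_cast (Rat.cast_le (K := ℝ)).2 a
    · exact_mod_cast (Rat.cast_lt (K := ℝ)).2 b
  obtain ⟨a1, a2⟩ := e1 ⌊A⌋₊
  obtain ⟨b1, b2⟩ := e1 ⌊B⌋₊
  have fA := Nat.floor_le hA
  have fA' := Nat.sub_one_lt_floor A
  have fB := Nat.floor_le hB
  have fB' := Nat.sub_one_lt_floor B
  have hd0 : (0 : ℝ) < d := by linarith
  have key : ∀ u v : ℝ, u ≤ v → (u - c) / d ≤ (v - c) / d := fun u v huv => by gcongr
  have k1 := key _ _ fA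
  have k2 := key _ _ fA'.le
  have k3 := key _ _ fB
  have k4 := key _ _ fB'.le
  have hinv : 1 / (d : ℝ) ≤ 1 := by rw [div_le_one hd0]; exact hdr
  have s1 : (B - A) / d = (B - c) / d - (A - c) / d := by ring
  have s2 : ∀ u : ℝ, (u - 1 - c) / d = (u - c) / d - 1 / d := fun u => by ring
  rw [s2] at k2 k4
  rw [h', s1, abs_le]
  constructor <;> linarith

/-- The lattice points `(j, x)` with positive coordinates in the triangle
`α Y - β j < x ≤ Y - γ j`. -/
noncomputable def wedge (α β γ Y : ℝ) : Finset (ℕ × ℕ) :=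
  ((Finset.Icc 1 ⌊(1 - α) / (γ - β) * Y⌋₊) ×ˢ (Finset.Icc 1 ⌊Y⌋₊)).filter
    (fun p => α * Y - β * p.1 < p.2 ∧ (p.2 : ℝ) ≤ Y - γ * p.1)

/-- The shape of the triangles to which the counting results apply: its third vertex
lies in the closed first quadrant. -/
structure WedgeShape (α β γ : ℝ) : Prop where
  nonneg : 0 ≤ α
  lt_one : α < 1
  slope_lt : β < γ
  slope_nonneg : 0 ≤ γ
  vertex : β ≤ α * γ

namespace WedgeShape

variable {α β γ : ℝ}

theorem delta_nonneg (h : WedgeShape α β γ) : 0 ≤ (1 - α) / (γ - β) :=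
  div_nonneg (by linarith [h.lt_one]) (by linarith [h.slope_lt])

theorem le_of_le_delta (h : WedgeShape α β γ) {Y t : ℝ}
    (ht : t ≤ (1 - α) / (γ - β) * Y) : α * Y - β * t ≤ Y - γ * t := by
  have hs : 0 < γ - β := by linarith [h.slope_lt]
  rw [div_mul_eq_mul_div, le_div_iff₀ hs] at ht
  linarith

/-- With `L` and `U` the lower and upper edges at `t`, the vertex condition gives `L ≥ αU ≥ αL`, so
`(1 - α)L ≥ 0`. Natural-number floors of the edges therefore lose nothing. -/
theorem lower_nonneg (h : WedgeShape α β γ) {Y t : ℝ} (h0 : 0 ≤ t)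
    (ht : t ≤ (1 - α) / (γ - β) * Y) : 0 ≤ α * Y - β * t := by
  have h1 := h.le_of_le_delta ht
  have h2 := mul_le_mul_of_nonneg_right h.vertex h0
  have h3 := mul_le_mul_of_nonneg_left h1 h.nonneg
  have h4 := h.lt_one
  nlinarith

theorem mem_wedge (h : WedgeShape α β γ) {Y : ℝ} {p : ℕ × ℕ} :
    p ∈ wedge α β γ Y ↔ 0 < p.1 ∧ α * Y - β * p.1 < p.2 ∧ (p.2 : ℝ) ≤ Y - γ * p.1 := by
  simp only [wedge, Finset.mem_filter, Finset.mem_product, Finset.mem_Icc]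
  constructor
  · rintro ⟨⟨⟨h1, -⟩, -⟩, h2⟩
    exact ⟨h1, h2⟩
  · rintro ⟨h1, h2, h3⟩
    have hs : 0 < γ - β := by linarith [h.slope_lt]
    have hj : (p.1 : ℝ) ≤ (1 - α) / (γ - β) * Y := by
      rw [div_mul_eq_mul_div, le_div_iff₀ hs]
      linarith
    have hp := h.lower_nonneg (Nat.cast_nonneg p.1) hj
    have hx : (0 : ℝ) < p.2 := hp.trans_lt h2
    refine ⟨⟨⟨h1, Nat.le_floor hj⟩, by exact_mod_cast hx, Nat.le_floor ?_⟩, h2, h3⟩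
    have := mul_nonneg h.slope_nonneg (Nat.cast_nonneg (α := ℝ) p.1)
    linarith

/-- A crude bounding box; being valid for every `Y ≥ 0`, it supplies the dominating series for the
Möbius sum. -/
theorem card_wedge_le (h : WedgeShape α β γ) {Y : ℝ} (hY : 0 ≤ Y) :
    ((wedge α β γ Y).card : ℝ) ≤ (1 - α) / (γ - β) * Y ^ 2 := by
  have h1 : (wedge α β γ Y).card ≤ ⌊(1 - α) / (γ - β) * Y⌋₊ * ⌊Y⌋₊ := by
    refine (Finset.card_filter_le _ _).trans ?_
    simp
  calc ((wedge α β γ Y).card : ℝ) ≤ (⌊(1 - α) / (γ - β) * Y⌋₊ : ℝ) * ⌊Y⌋₊ := by exact_mod_cast h1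
    _ ≤ ((1 - α) / (γ - β) * Y) * Y := by
      have := h.delta_nonneg
      gcongr
      · exact Nat.floor_le (by positivity)
      · exact Nat.floor_le hY
    _ = _ := by ring

theorem card_wedge_filter_modEq (h : WedgeShape α β γ) {Y : ℝ} (hY : 0 ≤ Y) (d c : ℕ) :
    ((wedge α β γ Y).filter (fun p => p.2 ≡ c [MOD d])).card =
      ∑ j ∈ Finset.Icc 1 ⌊(1 - α) / (γ - β) * Y⌋₊,
        ((Finset.Ioc ⌊α * Y - β * j⌋₊ ⌊Y - γ * j⌋₊).filter (fun x => x ≡ c [MOD d])).card := by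
  rw [wedge, Finset.filter_filter, Finset.card_filter, Finset.sum_product]
  refine Finset.sum_congr rfl fun j hj => ?_
  rw [← Finset.card_filter]
  congr 1
  ext x
  have hδ := h.delta_nonneg
  have hj' : (j : ℝ) ≤ (1 - α) / (γ - β) * Y :=
    (Nat.le_floor_iff (by positivity)).1 (Finset.mem_Icc.1 hj).2
  have hA := h.lower_nonneg (Nat.cast_nonneg j) hj'
  have hB := hA.trans (h.le_of_le_delta hj')
  simp only [Finset.mem_filter, Finset.mem_Icc, Finset.mem_Ioc]
  rw [Nat.floor_lt hA, Nat.le_floor_iff hB]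
  constructor
  · rintro ⟨-, ⟨h1, h2⟩, h3⟩
    exact ⟨⟨h1, h2⟩, h3⟩
  · rintro ⟨⟨h1, h2⟩, h3⟩
    have hx : (0 : ℝ) < x := hA.trans_lt h1
    have := mul_nonneg h.slope_nonneg (Nat.cast_nonneg (α := ℝ) j)
    exact ⟨⟨by exact_mod_cast hx, Nat.le_floor (by linarith)⟩, ⟨h1, h2⟩, h3⟩

/-- Summation over columns: column `j` has length `(1 - α)Y - (γ - β)j`, and each column contributes
an error of at most 2. -/
theorem abs_card_wedge_filter_sub_le (h : WedgeShape α β γ) {Y : ℝ} (hY : 0 ≤ Y) {d : ℕ}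
    (hd : 0 < d) (c : ℕ) :
    |(((wedge α β γ Y).filter (fun p => p.2 ≡ c [MOD d])).card : ℝ) -
      ((1 - α) * Y * ⌊(1 - α) / (γ - β) * Y⌋₊ - (γ - β) *
        ((⌊(1 - α) / (γ - β) * Y⌋₊ : ℝ) * (⌊(1 - α) / (γ - β) * Y⌋₊ + 1) / 2)) / d| ≤
      2 * ⌊(1 - α) / (γ - β) * Y⌋₊ := by
  rw [h.card_wedge_filter_modEq hY]
  have hgauss : ∀ J : ℕ, ∑ j ∈ Finset.Icc 1 J, (j : ℝ) = (J : ℝ) * (J + 1) / 2 := by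
    intro J
    induction J with
    | zero => simp
    | succ n ih =>
      rw [Finset.sum_Icc_succ_top (by omega), ih]
      push_cast
      ring
  have hδ := h.delta_nonneg
  have hJ : (⌊(1 - α) / (γ - β) * Y⌋₊ : ℝ) ≤ (1 - α) / (γ - β) * Y :=
    Nat.floor_le (by positivity)
  generalize ⌊(1 - α) / (γ - β) * Y⌋₊ = J at *
  have hmain : ((1 - α) * Y * J - (γ - β) * ((J : ℝ) * (J + 1) / 2)) / d =
      ∑ j ∈ Finset.Icc 1 J, ((Y - γ * j) - (α * Y - β * j)) / (d : ℝ) := by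
    rw [← hgauss, ← Finset.sum_div, Finset.mul_sum]
    congr 1
    have : (1 - α) * Y * (J : ℝ) = ∑ j ∈ Finset.Icc 1 J, (1 - α) * Y := by
      simp; ring
    rw [this, ← Finset.sum_sub_distrib]
    exact Finset.sum_congr rfl fun j _ => by ring
  rw [hmain]
  push_cast
  rw [← Finset.sum_sub_distrib]
  refine (Finset.abs_sum_le_sum_abs _ _).trans ?_
  refine (Finset.sum_le_card_nsmul _ _ 2 fun j hj => ?_).trans (by simp; linarith)
  have hj' : (j : ℝ) ≤ (1 - α) / (γ - β) * Y :=
    le_trans (by exact_mod_cast (Finset.mem_Icc.1 hj).2) hJ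
  exact abs_card_Ioc_filter_modEq_sub_le (h.lower_nonneg (Nat.cast_nonneg j) hj')
    (h.le_of_le_delta hj') hd c

theorem tendsto_card_wedge_filter (h : WedgeShape α β γ) {d : ℕ} (hd : 0 < d) (c : ℕ) :
    Tendsto (fun Y : ℝ =>
      (((wedge α β γ Y).filter (fun p => p.2 ≡ c [MOD d])).card : ℝ) / Y ^ 2) atTop
      (𝓝 ((1 - α) ^ 2 / (2 * (γ - β) * d))) := by
  set δ := (1 - α) / (γ - β) with hδd
  have hs : 0 < γ - β := by linarith [h.slope_lt]
  have hJ : Tendsto (fun Y : ℝ => (⌊δ * Y⌋₊ : ℝ) / Y) atTop (𝓝 δ) :=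
    tendsto_nat_floor_mul_div_atTop h.delta_nonneg
  have hinv : Tendsto (fun Y : ℝ => Y⁻¹) atTop (𝓝 0) := tendsto_inv_atTop_zero
  have herr : Tendsto (fun Y : ℝ => 2 * ((⌊δ * Y⌋₊ : ℝ) / Y) * Y⁻¹) atTop (𝓝 0) := by
    simpa using (hJ.const_mul 2).mul hinv
  have hmain : Tendsto (fun Y : ℝ => ((1 - α) * ((⌊δ * Y⌋₊ : ℝ) / Y) - (γ - β) *
      (((⌊δ * Y⌋₊ : ℝ) / Y) * ((⌊δ * Y⌋₊ : ℝ) / Y + Y⁻¹) / 2)) / d) atTop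
      (𝓝 (((1 - α) * δ - (γ - β) * (δ * (δ + 0) / 2)) / d)) :=
    ((hJ.const_mul _).sub (((hJ.mul (hJ.add hinv)).div_const 2).const_mul _)).div_const _
  have hval : ((1 - α) * δ - (γ - β) * (δ * (δ + 0) / 2)) / d =
      (1 - α) ^ 2 / (2 * (γ - β) * d) := by
    have hd' : (d : ℝ) ≠ 0 := by exact_mod_cast hd.ne'
    rw [hδd]
    field_simp
    ring
  rw [← hval]
  refine tendsto_of_tendsto_of_dist hmain ?_
  refine squeeze_zero' (Eventually.of_forall fun _ => dist_nonneg) ?_ herr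
  filter_upwards [eventually_gt_atTop 0] with Y hY
  have hb := h.abs_card_wedge_filter_sub_le hY.le hd c
  rw [← hδd] at hb
  rw [dist_comm, Real.dist_eq]
  have e : ∀ N J : ℝ, N / Y ^ 2 -
      ((1 - α) * (J / Y) - (γ - β) * ((J / Y) * (J / Y + Y⁻¹) / 2)) / d =
      (N - ((1 - α) * Y * J - (γ - β) * (J * (J + 1) / 2)) / d) / Y ^ 2 := by
    intro N J
    field_simp
  rw [e, abs_div, abs_of_pos (by positivity : (0 : ℝ) < Y ^ 2), div_le_iff₀ (by positivity)]
  refine hb.trans (le_of_eq ?_)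
  field_simp

end WedgeShape

/-! ### Coprime lattice points by Möbius inversion. -/

/-- The cutoff `N` makes the range of `n` independent of the point, so that the sums over `n` and
over points can be interchanged. -/
theorem ite_coprime_eq_sum_moebius (a b N : ℕ) (hb : 0 < b) (hN : b ≤ N) :
    (if a.Coprime b then (1 : ℤ) else 0) =
      ∑ n ∈ Finset.Icc 1 N, if n ∣ a ∧ n ∣ b then ArithmeticFunction.moebius n else 0 := by
  have h := congrArg (fun f => f (a.gcd b)) ArithmeticFunction.moebius_mul_coe_zeta
  simp only [ArithmeticFunction.coe_mul_zeta_apply, ArithmeticFunction.one_apply] at h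
  rw [← Finset.sum_filter]
  have hset : (Finset.Icc 1 N).filter (fun n => n ∣ a ∧ n ∣ b) = (a.gcd b).divisors := by
    ext n
    simp only [Finset.mem_filter, Finset.mem_Icc, Nat.mem_divisors, Nat.dvd_gcd_iff]
    constructor
    · rintro ⟨-, h⟩
      exact ⟨h, (Nat.gcd_pos_of_pos_right a hb).ne'⟩
    · rintro ⟨h, -⟩
      exact ⟨⟨Nat.pos_of_dvd_of_pos h.2 hb, (Nat.le_of_dvd hb h.2).trans hN⟩, h⟩
  rw [hset, h]

namespace WedgeShape

variable {α β γ : ℝ}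

theorem mul_mem_wedge_iff (h : WedgeShape α β γ) {Y : ℝ} {n : ℕ} (hn : 0 < n)
    (p : ℕ × ℕ) : (n * p.1, n * p.2) ∈ wedge α β γ Y ↔ p ∈ wedge α β γ (Y / n) := by
  have hn' : (0 : ℝ) < n := by exact_mod_cast hn
  rw [h.mem_wedge, h.mem_wedge]
  have e1 : α * (Y / n) - β * p.1 = (α * Y - β * (n * p.1)) / n := by field_simp
  have e2 : Y / n - γ * p.1 = (Y - γ * (n * p.1)) / n := by field_simp
  rw [e1, e2, div_lt_iff₀ hn', le_div_iff₀ hn']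
  push_cast
  rw [mul_comm (p.2 : ℝ)]
  simp [hn]

theorem card_wedge_filter_dvd (h : WedgeShape α β γ) {Y : ℝ} {n : ℕ} (hn : 0 < n)
    (P : ℕ → Prop) [DecidablePred P] :
    ((wedge α β γ Y).filter (fun p => (n ∣ p.1 ∧ n ∣ p.2) ∧ P p.2)).card =
      ((wedge α β γ (Y / n)).filter (fun p => P (n * p.2))).card := by
  symm
  refine Finset.card_bij (fun p _ => (n * p.1, n * p.2)) ?_ ?_ ?_
  · intro p hp
    rw [Finset.mem_filter] at hp ⊢
    exact ⟨(h.mul_mem_wedge_iff hn p).2 hp.1, ⟨⟨dvd_mul_right _ _, dvd_mul_right _ _⟩, hp.2⟩⟩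
  · rintro ⟨a, b⟩ _ ⟨a', b'⟩ _ he
    simp only [Prod.mk.injEq] at he ⊢
    exact ⟨Nat.eq_of_mul_eq_mul_left hn he.1, Nat.eq_of_mul_eq_mul_left hn he.2⟩
  · rintro ⟨a, b⟩ hp
    rw [Finset.mem_filter] at hp
    obtain ⟨hp, ⟨⟨a', rfl⟩, ⟨b', rfl⟩⟩, h3⟩ := hp
    exact ⟨(a', b'), Finset.mem_filter.2 ⟨(h.mul_mem_wedge_iff hn (a', b')).1 hp, h3⟩, rfl⟩

theorem card_wedge_filter_coprime (h : WedgeShape α β γ) (Q : ℕ) (P : ℕ → Prop)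
    [DecidablePred P] :
    (((wedge α β γ Q).filter (fun p => p.1.Coprime p.2 ∧ P p.2)).card : ℝ) =
      ∑' n : ℕ, (ArithmeticFunction.moebius n : ℝ) *
        ((wedge α β γ ((Q : ℝ) / n)).filter (fun p => P (n * p.2))).card := by
  -- The series is finite: `μ 0 = 0`, and the triangle of size `Q / n < 1` contains no points. The
  -- infinite form is kept for dominated convergence.
  rw [tsum_eq_sum (s := Finset.Icc 1 Q)]
  · have hZ : (((wedge α β γ Q).filter (fun p => p.1.Coprime p.2 ∧ P p.2)).card : ℤ) =
        ∑ n ∈ Finset.Icc 1 Q, ArithmeticFunction.moebius n *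
          (((wedge α β γ ((Q : ℝ) / n)).filter (fun p => P (n * p.2))).card : ℤ) := by
      have hterm : ∀ n ∈ Finset.Icc 1 Q, ArithmeticFunction.moebius n *
          (((wedge α β γ ((Q : ℝ) / n)).filter (fun p => P (n * p.2))).card : ℤ) =
          ∑ p ∈ (wedge α β γ Q).filter (fun p => P p.2),
            if n ∣ p.1 ∧ n ∣ p.2 then ArithmeticFunction.moebius n else 0 := by
        intro n hn
        rw [← h.card_wedge_filter_dvd (Finset.mem_Icc.1 hn).1, ← Finset.sum_filter,
          Finset.sum_const, Finset.filter_filter, nsmul_eq_mul, mul_comm]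
        congr 4
        ext p
        exact and_comm
      rw [Finset.sum_congr rfl hterm, Finset.sum_comm]
      have hin : ∀ p ∈ (wedge α β γ Q).filter (fun p => P p.2),
          (∑ n ∈ Finset.Icc 1 Q, if n ∣ p.1 ∧ n ∣ p.2 then ArithmeticFunction.moebius n else 0) =
          if p.1.Coprime p.2 then (1 : ℤ) else 0 := by
        intro p hp
        have hp' := (Finset.mem_product.1 (Finset.mem_filter.1 (Finset.mem_filter.1 hp).1).1).2
        rw [Nat.floor_natCast, Finset.mem_Icc] at hp'
        exact (ite_coprime_eq_sum_moebius _ _ _ hp'.1 hp'.2).symm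
      rw [Finset.sum_congr rfl hin, ← Finset.sum_filter, Finset.sum_const, Finset.filter_filter,
        nsmul_eq_mul, mul_one]
      congr 3
      ext p
      exact and_comm
    exact_mod_cast congrArg (Int.cast : ℤ → ℝ) hZ
  · intro n hn
    rcases Nat.eq_zero_or_pos n with rfl | hn0
    · simp
    have hQn : Q < n := by
      by_contra hc
      exact hn (Finset.mem_Icc.2 ⟨hn0, not_lt.1 hc⟩)
    have : ⌊(Q : ℝ) / n⌋₊ = 0 := by
      rw [Nat.floor_eq_zero, div_lt_one (by exact_mod_cast hn0)]
      exact_mod_cast hQn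
    simp [wedge, this]

theorem tendsto_card_wedge_filter_mul (h : WedgeShape α β γ) {d c n : ℕ} (hd : 0 < d)
    (hn : 0 < n) (hcd : c.Coprime d) :
    Tendsto (fun Q : ℕ => (((wedge α β γ ((Q : ℝ) / n)).filter
      (fun p => n * p.2 ≡ c [MOD d])).card : ℝ) / (Q : ℝ) ^ 2) atTop
      (𝓝 (if n.Coprime d then (1 - α) ^ 2 / (2 * (γ - β) * d) / (n : ℝ) ^ 2 else 0)) := by
  have hn' : (0 : ℝ) < n := by exact_mod_cast hn
  split_ifs with hnd
  -- For `n` a unit modulo `d` the congruence is again a single residue class, that of `n⁻¹ c`;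
  -- otherwise it has no solution, since `c` is a unit.
  · obtain ⟨c', hc'⟩ : ∃ c', ∀ x, n * x ≡ c [MOD d] ↔ x ≡ c' [MOD d] := by
      have : NeZero d := ⟨hd.ne'⟩
      obtain ⟨u, hu⟩ := (ZMod.isUnit_iff_coprime n d).2 hnd
      refine ⟨((↑u⁻¹ : ZMod d) * c).val, fun x => ?_⟩
      rw [← ZMod.natCast_eq_natCast_iff, ← ZMod.natCast_eq_natCast_iff, ZMod.natCast_zmod_val]
      push_cast
      rw [← hu, Units.eq_inv_mul_iff_mul_eq]
    simp only [hc']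
    have hlim : Tendsto (fun Q : ℕ => (Q : ℝ) / n) atTop atTop :=
      tendsto_natCast_atTop_atTop.atTop_div_const hn'
    refine (((h.tendsto_card_wedge_filter hd c').comp hlim).div_const ((n : ℝ) ^ 2)).congr ?_
    intro Q
    simp only [Function.comp]
    field_simp
  · have : ∀ x, ¬ n * x ≡ c [MOD d] := by
      intro x hx
      apply hnd
      have h1 : (n * x).Coprime d := by
        rw [Nat.Coprime, hx.gcd_eq]
        exact hcd
      exact Nat.Coprime.coprime_mul_right h1
    simp [this]

theorem tendsto_card_wedge_coprime (h : WedgeShape α β γ) {d c : ℕ} (hd : 0 < d)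
    (hcd : c.Coprime d) :
    Tendsto (fun Q : ℕ => (((wedge α β γ Q).filter
      (fun p => p.1.Coprime p.2 ∧ p.2 ≡ c [MOD d])).card : ℝ) / (Q : ℝ) ^ 2) atTop
      (𝓝 ((1 - α) ^ 2 / (2 * (γ - β) * d) * moebiusSum d)) := by
  have hlim : Tendsto (fun Q : ℕ => ∑' n : ℕ, (ArithmeticFunction.moebius n : ℝ) *
      ((((wedge α β γ ((Q : ℝ) / n)).filter (fun p => n * p.2 ≡ c [MOD d])).card : ℝ) /
        (Q : ℝ) ^ 2)) atTop
      (𝓝 (∑' n : ℕ, (ArithmeticFunction.moebius n : ℝ) *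
        (if n.Coprime d then (1 - α) ^ 2 / (2 * (γ - β) * d) / (n : ℝ) ^ 2 else 0))) := by
    -- The bounding box of the triangle of size `Q / n`, divided by `Q²`, gives a summable bound of
    -- order `1 / n²` uniform in `Q`.
    refine tendsto_tsum_of_dominated_convergence
      (bound := fun n : ℕ => (1 - α) / (γ - β) * (1 / (n : ℝ) ^ 2)) ?_ ?_ ?_
    · exact (Real.summable_one_div_nat_pow.2 one_lt_two).mul_left _
    · intro n
      rcases Nat.eq_zero_or_pos n with rfl | hn
      · simp
      · exact (h.tendsto_card_wedge_filter_mul hd hn hcd).const_mul _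
    · filter_upwards [eventually_gt_atTop 0] with Q hQ n
      rcases Nat.eq_zero_or_pos n with rfl | hn
      · simp
      have hQ' : (0 : ℝ) < Q := by exact_mod_cast hQ
      have hn' : (0 : ℝ) < n := by exact_mod_cast hn
      have hμ : |(ArithmeticFunction.moebius n : ℝ)| ≤ 1 := by
        exact_mod_cast ArithmeticFunction.abs_moebius_le_one (n := n)
      have hcard : (((wedge α β γ ((Q : ℝ) / n)).filter
          (fun p => n * p.2 ≡ c [MOD d])).card : ℝ) ≤ (1 - α) / (γ - β) * ((Q : ℝ) / n) ^ 2 :=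
        le_trans (by exact_mod_cast Finset.card_filter_le _ _)
          (h.card_wedge_le (Y := (Q : ℝ) / n) (by positivity))
      rw [norm_mul, Real.norm_eq_abs,
        Real.norm_of_nonneg (div_nonneg (Nat.cast_nonneg _) (sq_nonneg _))]
      refine (mul_le_of_le_one_left (by positivity) hμ).trans ?_
      rw [div_le_iff₀ (by positivity)]
      refine hcard.trans (le_of_eq ?_)
      field_simp
  convert! hlim using 2 with Q
  · rw [h.card_wedge_filter_coprime Q (fun x => x ≡ c [MOD d]), ← tsum_div_const]
    simp only [mul_div_assoc]
  · rw [moebiusSum, ← tsum_mul_left]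
    refine tsum_congr fun n => ?_
    split_ifs <;> ring

end WedgeShape

/-! ### Neighbours in the Farey sequence. -/

/-- `x` and `y` are neighbours in the Farey sequence of order `Q`. -/
def FareyNext (Q : ℕ) (x y : ℚ) : Prop :=
  x ∈ fareySet Q ∧ y ∈ fareySet Q ∧ x < y ∧ ∀ z ∈ fareySet Q, ¬ (x < z ∧ z < y)

theorem num_mul_den_lt_iff {x y : ℚ} : x < y ↔ x.num * y.den < y.num * x.den :=
  Rat.lt_iff x y

theorem num_den_of_isCoprime {a q : ℤ} (hq : 0 < q) (h : IsCoprime a q) :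
    ((a : ℚ) / q).num = a ∧ (((a : ℚ) / q).den : ℤ) = q := by
  have h' : Nat.Coprime a.natAbs q.natAbs := Int.isCoprime_iff_gcd_eq_one.1 h
  exact ⟨Rat.num_div_eq_of_coprime hq h', Rat.den_div_eq_of_coprime hq h'⟩

theorem mem_fareySet_div {a q : ℤ} {Q : ℕ} (h0 : 0 ≤ a) (h1 : a ≤ q) (hq : 0 < q) (hQ : q ≤ Q)
    (h : IsCoprime a q) : ((a : ℚ) / q) ∈ fareySet Q := by
  have hq' : (0 : ℚ) < q := by exact_mod_cast hq
  refine ⟨div_nonneg (by exact_mod_cast h0) hq'.le, ?_, ?_⟩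
  · rw [div_le_one hq']
    exact_mod_cast h1
  · have := (num_den_of_isCoprime hq h).2
    omega

theorem add_le_of_between {a q a' q' b s : ℤ} (hq : 0 < q) (hq' : 0 < q')
    (hdet : a' * q - a * q' = 1) (h1 : a * s < b * q) (h2 : b * q' < a' * s) : q + q' ≤ s := by
  -- Cramer's rule: `s` is a combination of `q` and `q'` with positive integer coefficients.
  have e : s = (b * q - a * s) * q' + (a' * s - b * q') * q := by
    linear_combination (-s) * hdet
  have h3 : 1 ≤ b * q - a * s := by omega
  have h4 : 1 ≤ a' * s - b * q' := by omega
  nlinarith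

theorem FareyNext.of_det {Q : ℕ} {x y : ℚ} (hx : x ∈ fareySet Q) (hy : y ∈ fareySet Q)
    (hdet : y.num * x.den - x.num * y.den = 1) (hQ : Q < x.den + y.den) : FareyNext Q x y := by
  refine ⟨hx, hy, num_mul_den_lt_iff.2 (by omega), ?_⟩
  rintro z hz ⟨h1, h2⟩
  have := add_le_of_between (by exact_mod_cast x.den_pos) (by exact_mod_cast y.den_pos) hdet
    (num_mul_den_lt_iff.1 h1) (num_mul_den_lt_iff.1 h2)
  have := hz.2.2
  omega

theorem exists_fareyNext_det {Q : ℕ} {x : ℚ} (hx : x ∈ fareySet Q) (hx1 : x < 1) :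
    ∃ y ∈ fareySet Q, y.num * x.den - x.num * y.den = 1 ∧ Q < x.den + y.den := by
  have hq : (0 : ℤ) < x.den := by exact_mod_cast x.den_pos
  have hqQ : (x.den : ℤ) ≤ Q := by exact_mod_cast hx.2.2
  have ha : 0 ≤ x.num := Rat.num_nonneg.2 hx.1
  have haq : x.num < x.den := Rat.num_lt_denom_iff.2 hx1
  obtain ⟨u, v, huv⟩ := x.isCoprime_num_den
  generalize hqd : (x.den : ℤ) = q at *
  generalize x.num = a at *
  have hmod := Int.emod_add_mul_ediv ((Q : ℤ) + u) q
  have hm0 := Int.emod_nonneg ((Q : ℤ) + u) hq.ne'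
  have hm1 := Int.emod_lt_of_pos ((Q : ℤ) + u) hq
  generalize hte : ((Q : ℤ) + u) / q = t at *
  -- The solutions of the determinant equation form a progression of step `q` in `q'`; this `t`
  -- selects the one in `(Q - q, Q]`.
  obtain ⟨q', hq'⟩ : ∃ q', q' = -u + q * t := ⟨_, rfl⟩
  obtain ⟨a', ha'⟩ : ∃ a', a' = v + a * t := ⟨_, rfl⟩
  have hdet : a' * q - a * q' = 1 := by
    rw [ha', hq']
    linear_combination huv
  have hq1 : q' ≤ Q := by omega
  have hq2 : (Q : ℤ) < q + q' := by omega
  have hq0 : 0 < q' := by omega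
  have hcop : IsCoprime a' q' := ⟨q, -a, by linear_combination hdet⟩
  have ha0 : 0 ≤ a' := by
    by_contra hc
    nlinarith [mul_nonneg ha hq0.le]
  have ha1 : a' ≤ q' := by
    by_contra hc
    nlinarith
  have hnd := num_den_of_isCoprime hq0 hcop
  refine ⟨(a' : ℚ) / q', mem_fareySet_div ha0 ha1 hq0 hq1 hcop, ?_, ?_⟩
  · rw [hnd.1, hnd.2]
    exact hdet
  · have := hnd.2
    omega

theorem FareyNext.unique {Q : ℕ} {x y z : ℚ} (hy : FareyNext Q x y) (hz : FareyNext Q x z) :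
    y = z := by
  rcases lt_trichotomy y z with h | h | h
  · exact absurd ⟨hy.2.2.1, h⟩ (hz.2.2.2 y hy.2.1)
  · exact h
  · exact absurd ⟨hz.2.2.1, h⟩ (hy.2.2.2 z hz.2.1)

theorem FareyNext.det {Q : ℕ} {x y : ℚ} (h : FareyNext Q x y) :
    y.num * x.den - x.num * y.den = 1 ∧ Q < x.den + y.den := by
  obtain ⟨z, hz, h1, h2⟩ := exists_fareyNext_det h.1 (h.2.2.1.trans_le h.2.1.2.1)
  rw [h.unique (FareyNext.of_det h.1 hz h1 h2)]
  exact ⟨h1, h2⟩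

/-- The determinant relation fixes the numerator of `x` modulo its denominator, and that numerator
lies in `[0, den)`. -/
theorem FareyNext.eq_of_den_eq {Q : ℕ} {x y x' y' : ℚ} (h : FareyNext Q x y)
    (h' : FareyNext Q x' y') (hx : x.den = x'.den) (hy : y.den = y'.den) : x = x' := by
  have e := h.det.1
  have e' := h'.det.1
  rw [← hx, ← hy] at e'
  have hlt : ∀ {u v : ℚ}, FareyNext Q u v → 0 ≤ u.num ∧ u.num < u.den := fun {u v} k =>
    ⟨Rat.num_nonneg.2 k.1.1, Rat.num_lt_denom_iff.2 (k.2.2.1.trans_le k.2.1.2.1)⟩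
  have b := hlt h
  have b' := hlt h'
  rw [← hx] at b'
  have hcop : IsCoprime (x.den : ℤ) y.den := ⟨y.num, -x.num, by linear_combination e⟩
  have hdvd : (x.den : ℤ) ∣ x.num - x'.num := by
    refine hcop.dvd_of_dvd_mul_right ⟨y.num - y'.num, ?_⟩
    linear_combination e' - e
  have hz : x.num - x'.num = 0 := by
    refine Int.eq_zero_of_abs_lt_dvd hdvd ?_
    rw [abs_lt]
    omega
  exact Rat.ext (by omega) hx

/-- Subtracting the two determinant relations shows that the middle denominator divides its
numerator times the sum of the outer denominators. -/
theorem FareyNext.exists_mul_den_eq {Q : ℕ} {x y z : ℚ} (h : FareyNext Q x y)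
    (h' : FareyNext Q y z) : ∃ k : ℤ, (x.den : ℤ) + z.den = k * y.den := by
  have e := h.det.1
  have e' := h'.det.1
  have hcop : IsCoprime (y.den : ℤ) y.num := ⟨-x.num, x.den, by linear_combination e⟩
  obtain ⟨k, hk⟩ : (y.den : ℤ) ∣ x.den + z.den := by
    refine hcop.dvd_of_dvd_mul_right ⟨x.num + z.num, ?_⟩
    linear_combination e - e'
  exact ⟨k, by rw [hk, mul_comm]⟩

/-! ### Indices of tuples in one residue class. -/

/-- If `k ≥ 5`, then `5q₁ - q₂ ≤ q₀ ≤ Q < q₁ + q₂` gives `2q₁ < q₂`, while `2q₂ - q₁ ≤ q₃ ≤ Q < q₁ +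
q₂` gives `q₂ < 2q₁`. -/
theorem index_lt_five {Q q₀ q₁ q₂ q₃ k l : ℤ} (h₁ : 0 < q₁) (h₂ : 0 < q₂)
    (l₀ : q₀ ≤ Q) (l₃ : q₃ ≤ Q) (s₁ : Q < q₁ + q₂) (hk : q₀ + q₂ = k * q₁)
    (hl : q₁ + q₃ = l * q₂) (hl2 : 2 ≤ l) : k < 5 := by
  by_contra hc
  have h5 : 5 * q₁ ≤ k * q₁ := mul_le_mul_of_nonneg_right (by omega) h₁.le
  have h6 : 2 * q₂ ≤ l * q₂ := mul_le_mul_of_nonneg_right hl2 h₂.le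
  omega

theorem index_eq_two {Q d c q₀ q₁ q₂ q₃ q₄ k₁ k₂ k₃ : ℤ} (hd : 2 ≤ d) (hcd : IsCoprime c d)
    (p₀ : 0 < q₀) (p₁ : 0 < q₁) (p₂ : 0 < q₂) (p₃ : 0 < q₃) (p₄ : 0 < q₄)
    (l₀ : q₀ ≤ Q) (l₁ : q₁ ≤ Q) (l₃ : q₃ ≤ Q) (l₄ : q₄ ≤ Q)
    (s₁ : Q < q₁ + q₂) (s₂ : Q < q₂ + q₃) (s₃ : Q < q₃ + q₄)
    (m₀ : q₀ ≡ c [ZMOD d]) (m₁ : q₁ ≡ c [ZMOD d]) (m₂ : q₂ ≡ c [ZMOD d])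
    (m₃ : q₃ ≡ c [ZMOD d]) (m₄ : q₄ ≡ c [ZMOD d])
    (e₁ : q₀ + q₂ = k₁ * q₁) (e₂ : q₁ + q₃ = k₂ * q₂) (e₃ : q₂ + q₄ = k₃ * q₃) :
    k₁ = 2 ∧ k₂ = 2 ∧ k₃ = 2 := by
  have key : ∀ {x y z k : ℤ}, 0 < x → 0 < y → 0 < z → x ≡ c [ZMOD d] → y ≡ c [ZMOD d] →
      z ≡ c [ZMOD d] → x + z = k * y → 2 ≤ k ∧ k ≠ 3 := by
    intro x y z k hx hy hz mx my mz e
    have h1 : c + c ≡ k * c [ZMOD d] := by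
      have := (mx.add mz).symm
      rw [e] at this
      exact this.trans (my.mul_left k)
    have h2 : d ∣ k - 2 := by
      refine hcd.symm.dvd_of_dvd_mul_right ?_
      have := h1.dvd
      rwa [show (k - 2) * c = k * c - (c + c) by ring]
    have hk : 0 < k := by
      by_contra hc
      nlinarith
    have hne : ∀ s : ℤ, s = 1 ∨ s = -1 → k - 2 ≠ s := by
      intro s hs h
      rw [h] at h2
      have : d ∣ 1 := by
        rcases hs with rfl | rfl
        · exact h2
        · exact (Int.dvd_neg).1 h2
      have := Int.le_of_dvd one_pos this
      omega
    have a := hne 1 (Or.inl rfl)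
    have b := hne (-1) (Or.inr rfl)
    omega
  obtain ⟨a₁, b₁⟩ := key p₀ p₁ p₂ m₀ m₁ m₂ e₁
  obtain ⟨a₂, b₂⟩ := key p₁ p₂ p₃ m₁ m₂ m₃ e₂
  obtain ⟨a₃, b₃⟩ := key p₂ p₃ p₄ m₂ m₃ m₄ e₃
  have c₁ := index_lt_five p₁ p₂ l₀ l₃ s₁ e₁ e₂ a₂
  have c₂ := index_lt_five p₂ p₃ l₁ l₄ s₂ e₂ e₃ a₃
  -- The last index has no right neighbour, so the bound is applied to the reversed tuple.
  have c₃ := index_lt_five p₃ p₂ l₄ l₁ (by omega) (by rw [add_comm]; exact e₃)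
    (by rw [add_comm]; exact e₂) a₂
  have d₁ : k₁ = 2 ∨ k₁ = 4 := by omega
  have d₂ : k₂ = 2 ∨ k₂ = 4 := by omega
  have d₃ : k₃ = 2 ∨ k₃ = 4 := by omega
  rcases d₁ with rfl | rfl <;> rcases d₂ with rfl | rfl <;> rcases d₃ with rfl | rfl <;> omega

theorem den_arithmetic {Q r d c : ℕ} (hr : 5 ≤ r) (hd : 2 ≤ d) (hcd : c.Coprime d) {g : ℕ → ℚ}
    (hg : ∀ i, i + 1 < r → FareyNext Q (g i) (g (i + 1)))
    (hm : ∀ i < r, (g i).den ≡ c [MOD d]) (i : ℕ) (hi : i < r) :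
    ((g i).den : ℤ) = (g 0).den + i * ((g 1).den - (g 0).den) := by
  have hpos : ∀ i, (0 : ℤ) < (g i).den := fun i => by exact_mod_cast (g i).den_pos
  have hle : ∀ i < r, ((g i).den : ℤ) ≤ Q := by
    intro i hi
    rcases Nat.eq_zero_or_pos i with rfl | h
    · exact_mod_cast (hg 0 (by omega)).1.2.2
    · have := (hg (i - 1) (by omega)).2.1.2.2
      rw [Nat.sub_add_cancel h] at this
      exact_mod_cast this
  have hsum : ∀ i, i + 1 < r → (Q : ℤ) < (g i).den + (g (i + 1)).den := fun i hi => by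
    exact_mod_cast (hg i hi).det.2
  have hmz : ∀ i < r, ((g i).den : ℤ) ≡ c [ZMOD d] := fun i hi =>
    Int.natCast_modEq_iff.2 (hm i hi)
  have hcz : IsCoprime (c : ℤ) d := Nat.isCoprime_iff_coprime.2 hcd
  have hk : ∀ i, i + 2 < r → ∃ k : ℤ,
      ((g i).den : ℤ) + (g (i + 2)).den = k * (g (i + 1)).den := fun i hi =>
    (hg i (by omega)).exists_mul_den_eq (hg (i + 1) hi)
  have win : ∀ s, s + 4 < r → ∀ i, s ≤ i → i ≤ s + 2 →
      ((g i).den : ℤ) + (g (i + 2)).den = 2 * (g (i + 1)).den := by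
    intro s hs
    obtain ⟨k₁, e₁⟩ := hk s (by omega)
    obtain ⟨k₂, e₂⟩ := hk (s + 1) (by omega)
    obtain ⟨k₃, e₃⟩ := hk (s + 2) (by omega)
    obtain ⟨rfl, rfl, rfl⟩ := index_eq_two (by exact_mod_cast hd) hcz (hpos s) (hpos (s + 1))
      (hpos (s + 2)) (hpos (s + 3)) (hpos (s + 4)) (hle s (by omega)) (hle _ (by omega))
      (hle _ (by omega)) (hle _ (by omega))
      (hsum (s + 1) (by omega)) (hsum (s + 2) (by omega)) (hsum (s + 3) (by omega))
      (hmz s (by omega)) (hmz _ (by omega)) (hmz _ (by omega)) (hmz _ (by omega))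
      (hmz _ (by omega)) e₁ e₂ e₃
    intro i h1 h2
    obtain rfl | rfl | rfl : i = s ∨ i = s + 1 ∨ i = s + 2 := by omega
    · exact e₁
    · exact e₂
    · exact e₃
  have hstep : ∀ i, i + 2 < r →
      ((g i).den : ℤ) + (g (i + 2)).den = 2 * (g (i + 1)).den := by
    intro i hi
    rcases le_total (i + 5) r with h | h
    · exact win i (by omega) i le_rfl (by omega)
    -- Near the right end the last five-term window is used.
    · exact win (r - 5) (by omega) i (by omega) (by omega)
  have hind : ∀ i, i + 1 < r → ((g i).den : ℤ) = (g 0).den + i * ((g 1).den - (g 0).den) ∧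
      ((g (i + 1)).den : ℤ) = (g 0).den + (i + 1) * ((g 1).den - (g 0).den) := by
    intro i
    induction i with
    | zero => intro _; constructor <;> push_cast <;> ring
    | succ n ih =>
      intro hn
      obtain ⟨h1, h2⟩ := ih (by omega)
      have h3 := hstep n hn
      refine ⟨by rw [h2]; push_cast; ring, ?_⟩
      push_cast
      have : ((g (n + 1 + 1)).den : ℤ) = 2 * (g (n + 1)).den - (g n).den := by
        rw [← h3]
        ring
      rw [this, h1, h2]
      ring
  rcases Nat.eq_zero_or_pos i with rfl | h
  · simp
  · have := (hind (i - 1) (by omega)).2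
    rw [Nat.sub_add_cancel h] at this
    rw [this]
    congr 2
    exact_mod_cast Nat.sub_add_cancel h

/-! ### Tuples with prescribed denominators. -/

/-- The numerators may be taken as a progression `a + kδ` with `δq - ae = 1`: all consecutive
determinants are then 1. Denominators being at least 2 keeps every fraction in `[0, 1)`. -/
theorem exists_fareySequence {Q r : ℕ} {q e : ℤ} (hcop : IsCoprime q e)
    (hq : ∀ k : ℕ, k < r → 2 ≤ q + k * e ∧ q + k * e ≤ Q)
    (hs : ∀ k : ℕ, k + 1 < r → (Q : ℤ) < 2 * q + (2 * k + 1) * e) (hr : 0 < r) :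
    ∃ g : ℕ → ℚ, (∀ k < r, g k ∈ fareySet Q ∧ ((g k).den : ℤ) = q + k * e) ∧
      ∀ k, k + 1 < r → FareyNext Q (g k) (g (k + 1)) := by
  obtain ⟨u, v, huv⟩ := hcop
  have hq0 : 2 ≤ q := by simpa using (hq 0 hr).1
  -- `δ q - a e = 1` with `0 ≤ a < q`
  obtain ⟨a, δ, ha0, haq, hdet⟩ : ∃ a δ : ℤ, 0 ≤ a ∧ a < q ∧ δ * q - a * e = 1 := by
    refine ⟨(-v) % q, u - ((-v) / q) * e, Int.emod_nonneg _ (by omega),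
      Int.emod_lt_of_pos _ (by omega), ?_⟩
    have := Int.emod_add_mul_ediv (-v) q
    linear_combination huv - e * this
  have hd : ∀ k : ℕ, (a + (k + 1) * δ) * (q + k * e) - (a + k * δ) * (q + (k + 1) * e) = 1 :=
    fun k => by linear_combination hdet
  have hc : ∀ k : ℕ, IsCoprime (a + k * δ) (q + k * e) := fun k =>
    ⟨-e, δ, by linear_combination hdet⟩
  have hb : ∀ k : ℕ, k < r → 0 ≤ a + k * δ ∧ a + k * δ < q + k * e := by
    intro k
    induction k with
    | zero => intro _; simpa using ⟨ha0, haq⟩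
    | succ n ih =>
      intro hn
      obtain ⟨h1, h2⟩ := ih (by omega)
      have h3 := hd n
      have h4 := (hq n (by omega)).1
      have h5 := (hq (n + 1) hn).1
      push_cast at h5 ⊢
      generalize a + ((n : ℤ) + 1) * δ = a' at *
      generalize q + ((n : ℤ) + 1) * e = q' at *
      generalize a + (n : ℤ) * δ = a₀ at *
      generalize q + (n : ℤ) * e = q₀ at *
      constructor
      · by_contra hneg
        nlinarith [mul_nonneg h1 (show (0 : ℤ) ≤ q' by omega)]
      · by_contra hneg
        nlinarith
  have hnd := fun (k : ℕ) (hk : k < r) =>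
    num_den_of_isCoprime (lt_of_lt_of_le two_pos (hq k hk).1) (hc k)
  have hmem : ∀ k : ℕ, k < r →
      (((a + k * δ : ℤ) : ℚ) / ((q + k * e : ℤ) : ℚ)) ∈ fareySet Q := fun k hk =>
    mem_fareySet_div (hb k hk).1 (hb k hk).2.le (lt_of_lt_of_le two_pos (hq k hk).1) (hq k hk).2
      (hc k)
  refine ⟨fun k => ((a + k * δ : ℤ) : ℚ) / ((q + k * e : ℤ) : ℚ),
    fun k hk => ⟨hmem k hk, (hnd k hk).2⟩, fun k hk => ?_⟩
  have n1 := hnd k (by omega)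
  have n2 := hnd (k + 1) hk
  refine FareyNext.of_det (hmem k (by omega)) (hmem (k + 1) hk) ?_ ?_
  · rw [n1.1, n1.2, n2.1, n2.2]
    push_cast
    exact hd k
  · have h := hs k hk
    refine (Nat.cast_lt (α := ℤ)).1 ?_
    rw [Nat.cast_add, n1.2, n2.2]
    push_cast
    linarith

theorem isConsecutiveFarey_iff {Q r : ℕ} {f : Fin r → ℚ} :
    IsConsecutiveFarey Q f ↔ (∀ j, f j ∈ fareySet Q) ∧
      ∀ i j : Fin r, (j : ℕ) = (i : ℕ) + 1 → FareyNext Q (f i) (f j) :=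
  ⟨fun h => ⟨h.1, fun i j hij => ⟨h.1 i, h.1 j, h.2 i j hij⟩⟩,
    fun h => ⟨h.1, fun i j hij => (h.2 i j hij).2.2⟩⟩

theorem IsConsecutiveFarey.eq_of_den_eq {Q r : ℕ} {f f' : Fin r → ℚ}
    (h : IsConsecutiveFarey Q f) (h' : IsConsecutiveFarey Q f') (hr : 1 < r)
    (h0 : (f ⟨0, by omega⟩).den = (f' ⟨0, by omega⟩).den)
    (h1 : (f ⟨1, hr⟩).den = (f' ⟨1, hr⟩).den) : f = f' := by
  rw [isConsecutiveFarey_iff] at h h'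
  have key : ∀ i (hi : i < r), f ⟨i, hi⟩ = f' ⟨i, hi⟩ := by
    intro i
    induction i with
    | zero =>
      intro _
      exact (h.2 ⟨0, by omega⟩ ⟨1, hr⟩ rfl).eq_of_den_eq (h'.2 ⟨0, by omega⟩ ⟨1, hr⟩ rfl) h0 h1
    | succ n ih =>
      intro hn
      have a := h.2 ⟨n, by omega⟩ ⟨n + 1, hn⟩ rfl
      rw [ih (by omega)] at a
      exact a.unique (h'.2 ⟨n, by omega⟩ ⟨n + 1, hn⟩ rfl)
  exact funext fun i => key i i.2

/-! ### Tuples and lattice points. -/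

/-- The positive lattice points `(j, x)` for which `x, x + d j, …, x + (r - 1) d j` are the
denominators of consecutive Farey fractions of order `Q`, all congruent to `c` modulo `d`. -/
noncomputable def progressionPoints (r d c Q : ℕ) : Finset (ℕ × ℕ) :=
  (wedge (1 / 2) ((d : ℝ) / 2) (((r - 1 : ℕ) : ℝ) * d) Q).filter
    (fun p => p.1.Coprime p.2 ∧ p.2 ≡ c [MOD d])

theorem wedgeShape_progression {r d : ℕ} (hr : 5 ≤ r) (hd : 2 ≤ d) :
    WedgeShape (1 / 2) ((d : ℝ) / 2) (((r - 1 : ℕ) : ℝ) * d) := by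
  have hd' : (2 : ℝ) ≤ d := by exact_mod_cast hd
  have hr' : (4 : ℝ) ≤ ((r - 1 : ℕ) : ℝ) := by exact_mod_cast (by omega : 4 ≤ r - 1)
  have h := mul_le_mul_of_nonneg_right hr' (by linarith : (0 : ℝ) ≤ d)
  constructor <;> linarith

theorem mem_progressionPoints {r d c Q : ℕ} (hr : 5 ≤ r) (hd : 2 ≤ d) {p : ℕ × ℕ} :
    p ∈ progressionPoints r d c Q ↔ (0 < p.1 ∧ Q < 2 * p.2 + d * p.1 ∧
      p.2 + (r - 1) * (d * p.1) ≤ Q) ∧ p.1.Coprime p.2 ∧ p.2 ≡ c [MOD d] := by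
  rw [progressionPoints, Finset.mem_filter, (wedgeShape_progression hr hd).mem_wedge]
  refine and_congr_left fun _ => and_congr_right fun _ => and_congr ?_ ?_
  · rw [← Nat.cast_lt (α := ℝ)]
    push_cast
    constructor <;> intro h <;> linarith
  · rw [← Nat.cast_le (α := ℝ)]
    push_cast
    constructor <;> intro h <;> linarith

/-- The first denominator and common difference of an increasing progression. -/
def ascending (d : ℕ) (p : ℕ × ℕ) : ℤ × ℤ := (p.2, d * p.1)

/-- The first denominator and common difference of a decreasing progression. -/
def descending (r d : ℕ) (p : ℕ × ℕ) : ℤ × ℤ := (p.2 + (r - 1 : ℕ) * (d * p.1), -(d * p.1))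

/-- The first denominator and the difference of the first two denominators of a tuple. -/
def initialDen {r : ℕ} (hr : 5 ≤ r) (f : Fin r → ℚ) : ℤ × ℤ :=
  ((f ⟨0, by omega⟩).den, (f ⟨1, by omega⟩).den - (f ⟨0, by omega⟩).den)

theorem exists_mem_fareyTuples {Q r d c : ℕ} (hr : 5 ≤ r) {q e : ℤ} (hcop : IsCoprime q e)
    (hq : ∀ k : ℕ, k < r → 2 ≤ q + k * e ∧ q + k * e ≤ Q)
    (hs : ∀ k : ℕ, k + 1 < r → (Q : ℤ) < 2 * q + (2 * k + 1) * e)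
    (hqc : q ≡ c [ZMOD d]) (hed : (d : ℤ) ∣ e) :
    ∃ f ∈ fareyTuples Q (fun _ : Fin r => c) d, initialDen hr f = (q, e) := by
  obtain ⟨g, h1, h2⟩ := exists_fareySequence hcop hq hs (by omega)
  refine ⟨fun i => g i, ⟨isConsecutiveFarey_iff.2 ⟨fun j => (h1 j j.2).1, fun i j hij => ?_⟩,
    fun j => ?_⟩, ?_⟩
  · simp only [hij]
    exact h2 i (by omega)
  · rw [← Int.natCast_modEq_iff, (h1 j j.2).2]
    have : (j : ℤ) * e ≡ 0 [ZMOD d] := Int.modEq_zero_iff_dvd.2 (hed.mul_left _)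
    simpa using hqc.add this
  · have a := (h1 0 (by omega)).2
    have b := (h1 1 (by omega)).2
    simp only [initialDen, a, b]
    simp

theorem isCoprime_mul_of_modEq {d c x j : ℕ} (hcd : c.Coprime d) (hj : j.Coprime x)
    (hx : x ≡ c [MOD d]) : IsCoprime (x : ℤ) (d * j : ℤ) := by
  have h1 : x.Coprime d := by
    rw [Nat.Coprime, hx.gcd_eq]
    exact hcd
  exact_mod_cast Nat.isCoprime_iff_coprime.2 (h1.mul_right hj.symm)

theorem exists_initialDen_eq_ascending {Q r d c : ℕ} (hr : 5 ≤ r) (hd : 2 ≤ d)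
    (hcd : c.Coprime d) {p : ℕ × ℕ} (hp : p ∈ progressionPoints r d c Q) :
    ∃ f ∈ fareyTuples Q (fun _ : Fin r => c) d, initialDen hr f = ascending d p := by
  obtain ⟨⟨h1, h2, h3⟩, h4, h5⟩ := (mem_progressionPoints hr hd).1 hp
  have he : 2 ≤ d * p.1 := hd.trans (Nat.le_mul_of_pos_right d h1)
  have h6 := isCoprime_mul_of_modEq hcd h4 h5
  have h7 := Int.natCast_modEq_iff.2 h5
  have h4r : 4 * (d * p.1) ≤ (r - 1) * (d * p.1) := Nat.mul_le_mul_right _ (by omega)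
  refine exists_mem_fareyTuples hr h6 (fun k hk => ?_) (fun k hk => ?_) h7 (dvd_mul_right _ _)
  · have h8 : k * (d * p.1) ≤ (r - 1) * (d * p.1) := Nat.mul_le_mul_right _ (by omega)
    zify at h2 h3 h4r h8 he
    have h9 : (0 : ℤ) ≤ k * (d * p.1) := by positivity
    constructor <;> linarith
  · zify at h2
    have h9 : (0 : ℤ) ≤ k * (d * p.1) := by positivity
    linarith

theorem exists_initialDen_eq_descending {Q r d c : ℕ} (hr : 5 ≤ r) (hd : 2 ≤ d)
    (hcd : c.Coprime d) {p : ℕ × ℕ} (hp : p ∈ progressionPoints r d c Q) :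
    ∃ f ∈ fareyTuples Q (fun _ : Fin r => c) d, initialDen hr f = descending r d p := by
  obtain ⟨⟨h1, h2, h3⟩, h4, h5⟩ := (mem_progressionPoints hr hd).1 hp
  have he : 2 ≤ d * p.1 := hd.trans (Nat.le_mul_of_pos_right d h1)
  have h6 := isCoprime_mul_of_modEq hcd h4 h5
  have h7 := Int.natCast_modEq_iff.2 h5
  have h4r : 4 * (d * p.1) ≤ (r - 1) * (d * p.1) := Nat.mul_le_mul_right _ (by omega)
  refine exists_mem_fareyTuples hr ?_ (fun k hk => ?_) (fun k hk => ?_) ?_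
    ((dvd_mul_right _ _).neg_right)
  · exact (h6.add_mul_right_left _).neg_right
  · obtain ⟨l, hl⟩ : ∃ l, r - 1 = k + l := ⟨r - 1 - k, by omega⟩
    rw [hl] at h3 h4r ⊢
    zify at h2 h3 h4r he
    have h9 : (0 : ℤ) ≤ k * (d * p.1) := by positivity
    have h10 : (0 : ℤ) ≤ l * (d * p.1) := by positivity
    push_cast
    constructor <;> linarith
  · obtain ⟨l, hl⟩ : ∃ l, r - 1 = k + 1 + l := ⟨r - 1 - (k + 1), by omega⟩
    rw [hl]
    zify at h2
    have h10 : (0 : ℤ) ≤ l * (d * p.1) := by positivity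
    push_cast
    linarith
  · have : (((r - 1 : ℕ) : ℤ)) * (d * p.1) ≡ 0 [ZMOD d] :=
      Int.modEq_zero_iff_dvd.2 ((dvd_mul_right _ _).mul_left _)
    simpa using h7.add this

theorem initialDen_mem {Q r d c : ℕ} (hQ : 2 ≤ Q) (hr : 5 ≤ r) (hd : 2 ≤ d)
    (hcd : c.Coprime d) {f : Fin r → ℚ} (hf : f ∈ fareyTuples Q (fun _ : Fin r => c) d) :
    ∃ p ∈ progressionPoints r d c Q,
      initialDen hr f = ascending d p ∨ initialDen hr f = descending r d p := by
  obtain ⟨hf, hm⟩ := hf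
  rw [isConsecutiveFarey_iff] at hf
  obtain ⟨g, hg⟩ : ∃ g : ℕ → ℚ, ∀ i (hi : i < r), f ⟨i, hi⟩ = g i :=
    ⟨fun i => if hi : i < r then f ⟨i, hi⟩ else 0, fun i hi => by simp [hi]⟩
  have hnext : ∀ i, i + 1 < r → FareyNext Q (g i) (g (i + 1)) := fun i hi => by
    rw [← hg i (by omega), ← hg (i + 1) hi]
    exact hf.2 _ _ rfl
  have hmod : ∀ i < r, (g i).den ≡ c [MOD d] := fun i hi => by
    rw [← hg i hi]
    exact hm _
  have har := den_arithmetic hr hd hcd hnext hmod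
  have hle : ∀ i < r, (g i).den ≤ Q := fun i hi => by
    rw [← hg i hi]
    exact (hf.1 _).2.2
  have hinit : initialDen hr f = (((g 0).den : ℤ), ((g 1).den : ℤ) - (g 0).den) := by
    simp only [initialDen, hg]
  have hdet := (hnext 0 (by omega)).det
  have hcop : IsCoprime ((g 0).den : ℤ) (g 1).den :=
    ⟨(g 1).num, -(g 0).num, by linear_combination hdet.1⟩
  have hlast := har (r - 1) (by omega)
  have hprev := har (r - 2) (by omega)
  have hsumlast := (hnext (r - 2) (by omega)).det.2
  rw [show r - 2 + 1 = r - 1 by omega] at hsumlast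
  obtain ⟨m, hmd⟩ : (d : ℤ) ∣ ((g 1).den : ℤ) - (g 0).den :=
    (Int.natCast_modEq_iff.2 ((hmod 0 (by omega)).trans (hmod 1 (by omega)).symm)).dvd
  have hcast : ((r - 2 : ℕ) : ℤ) = ((r - 1 : ℕ) : ℤ) - 1 := by omega
  rw [hmd] at hlast hprev hinit
  have h1 : ((g 1).den : ℤ) = (g 0).den + d * m := by linarith
  rw [h1] at hcop
  have hcop' : IsCoprime ((g 0).den : ℤ) (d * m) := by
    simpa using hcop.add_mul_left_right (-1)
  have hQ0 := hle 0 (by omega)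
  have hQl := hle (r - 1) (by omega)
  have hml := hmod (r - 1) (by omega)
  have hm0 := hmod 0 (by omega)
  have hd0 : (0 : ℤ) < d := by omega
  rcases lt_trichotomy m 0 with hneg | rfl | hpos
  · obtain ⟨j, rfl⟩ : ∃ j : ℕ, m = -(j : ℤ) := ⟨m.natAbs, by omega⟩
    refine ⟨(j, (g (r - 1)).den), (mem_progressionPoints hr hd).2
      ⟨⟨by simpa using hneg, ?_, ?_⟩, ?_, hml⟩, Or.inr ?_⟩
    · zify at hsumlast ⊢
      rw [hprev, hcast] at hsumlast
      linarith
    · zify at hQ0 ⊢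
      linarith
    · have : IsCoprime ((g (r - 1)).den : ℤ) (d * -(j : ℤ)) := by
        rw [hlast]
        exact hcop'.add_mul_right_left _
      have := (this.of_mul_right_right).neg_right
      rw [neg_neg] at this
      exact (Nat.isCoprime_iff_coprime.1 this).symm
    · rw [hinit, descending]
      ext <;> simp only <;> linarith
  -- A constant progression has all denominators 1 by coprimality, which contradicts `Q < 1 + 1` as
  -- `Q ≥ 2`.
  · exfalso
    have h := Int.isUnit_iff.1 (isCoprime_zero_right.1 (by simpa using hcop'))
    have := hdet.2
    omega
  · obtain ⟨j, rfl⟩ : ∃ j : ℕ, m = (j : ℤ) := ⟨m.natAbs, by omega⟩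
    refine ⟨(j, (g 0).den), (mem_progressionPoints hr hd).2
      ⟨⟨by simpa using hpos, ?_, ?_⟩, ?_, hm0⟩, Or.inl ?_⟩
    · have := hdet.2
      zify at this ⊢
      linarith
    · zify at hQl ⊢
      linarith
    · exact (Nat.isCoprime_iff_coprime.1 hcop'.of_mul_right_right).symm
    · rw [hinit, ascending]

/-- A tuple is determined by its first two denominators, and the sign of their difference separates
the increasing from the decreasing tuples. -/
theorem ncard_fareyTuples {Q r d c : ℕ} (hQ : 2 ≤ Q) (hr : 5 ≤ r) (hd : 2 ≤ d)
    (hcd : c.Coprime d) :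
    (fareyTuples Q (fun _ : Fin r => c) d).ncard = 2 * (progressionPoints r d c Q).card := by
  have hinj : Set.InjOn (initialDen hr) (fareyTuples Q (fun _ : Fin r => c) d) := by
    intro f hf f' hf' h
    simp only [initialDen, Prod.mk.injEq] at h
    exact hf.1.eq_of_den_eq hf'.1 (by omega) (by omega) (by omega)
  have himg : initialDen hr '' (fareyTuples Q (fun _ : Fin r => c) d) =
      ↑((progressionPoints r d c Q).image (ascending d) ∪
        (progressionPoints r d c Q).image (descending r d)) := by
    ext z
    simp only [Set.mem_image, Finset.coe_union, Finset.coe_image, Set.mem_union,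
      Finset.mem_coe]
    constructor
    · rintro ⟨f, hf, rfl⟩
      obtain ⟨p, hp, h | h⟩ := initialDen_mem hQ hr hd hcd hf
      · exact Or.inl ⟨p, hp, h.symm⟩
      · exact Or.inr ⟨p, hp, h.symm⟩
    · rintro (⟨p, hp, rfl⟩ | ⟨p, hp, rfl⟩)
      · exact exists_initialDen_eq_ascending hr hd hcd hp
      · exact exists_initialDen_eq_descending hr hd hcd hp
  have hd0 : (d : ℤ) ≠ 0 := by omega
  rw [← hinj.ncard_image, himg, Set.ncard_coe_finset, Finset.card_union_of_disjoint,
    Finset.card_image_of_injective, Finset.card_image_of_injective, two_mul]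
  · rintro ⟨a, b⟩ ⟨a', b'⟩ h
    simp only [descending, Prod.mk.injEq, neg_inj, mul_eq_mul_left_iff, hd0, or_false,
      Nat.cast_inj] at h
    obtain ⟨h1, rfl⟩ := h
    simpa using h1
  · rintro ⟨a, b⟩ ⟨a', b'⟩ h
    simp only [ascending, Prod.mk.injEq, mul_eq_mul_left_iff, hd0, or_false, Nat.cast_inj] at h
    simp [h]
  · rw [Finset.disjoint_left]
    rintro z h1 h2
    obtain ⟨p, hp, rfl⟩ := Finset.mem_image.1 h1
    obtain ⟨p', hp', h⟩ := Finset.mem_image.1 h2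
    have a := ((mem_progressionPoints hr hd).1 hp).1.1
    have h' := congrArg Prod.snd h
    simp only [ascending, descending] at h'
    have b : (0 : ℤ) < d * p.1 := by positivity
    have b' : (0 : ℤ) ≤ d * p'.1 := by positivity
    omega

/-! ### The size of the Farey sequence and the limit. -/

theorem wedgeShape_farey : WedgeShape 0 (-1) 0 := by
  constructor <;> norm_num

/-- The extra 2 counts `0/1` and `1/1`. The vacuous congruence modulo 1 puts the count in the form
of the general asymptotic. -/
theorem ncard_fareySet {Q : ℕ} (hQ : 1 ≤ Q) : (fareySet Q).ncard =
    ((wedge 0 (-1) 0 Q).filter (fun p => p.1.Coprime p.2 ∧ p.2 ≡ 1 [MOD 1])).card + 2 := by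
  have hmem : ∀ {p : ℕ × ℕ}, p ∈ (wedge 0 (-1) 0 Q).filter
      (fun p => p.1.Coprime p.2 ∧ p.2 ≡ 1 [MOD 1]) ↔
      (0 < p.1 ∧ p.1 < p.2 ∧ p.2 ≤ Q) ∧ p.1.Coprime p.2 := by
    intro p
    rw [Finset.mem_filter, wedgeShape_farey.mem_wedge]
    simp [Nat.modEq_one]
  generalize (wedge 0 (-1) 0 Q).filter (fun p => p.1.Coprime p.2 ∧ p.2 ≡ 1 [MOD 1]) = W at *
  have hinj : Set.InjOn (fun x : ℚ => (x.num.toNat, x.den)) (fareySet Q) := by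
    intro x hx y hy h
    simp only [Prod.mk.injEq] at h
    have := Rat.num_nonneg.2 hx.1
    have := Rat.num_nonneg.2 hy.1
    exact Rat.ext (by omega) h.2
  have himg : (fun x : ℚ => (x.num.toNat, x.den)) '' (fareySet Q) =
      ↑(W ∪ {((0 : ℕ), (1 : ℕ)), (1, 1)}) := by
    ext ⟨a, q⟩
    simp only [Set.mem_image, Finset.mem_coe, Finset.mem_union, hmem, Finset.mem_insert,
      Finset.mem_singleton, Prod.mk.injEq]
    constructor
    · rintro ⟨x, hx, rfl, rfl⟩
      have h0 := Rat.num_nonneg.2 hx.1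
      have h1 := Rat.num_le_denom_iff.2 hx.2.1
      have hc : x.num.toNat.Coprime x.den := by
        have := x.reduced
        rwa [show x.num.natAbs = x.num.toNat by omega] at this
      rcases Nat.eq_zero_or_pos x.num.toNat with h | h
      · rw [h, Nat.coprime_zero_left] at hc
        exact Or.inr (Or.inl ⟨h, hc⟩)
      rcases lt_or_ge x.num.toNat x.den with h' | h'
      · exact Or.inl ⟨⟨h, h', hx.2.2⟩, hc⟩
      · have he : x.num.toNat = x.den := by omega
        rw [he, Nat.coprime_self] at hc
        exact Or.inr (Or.inr ⟨by omega, hc⟩)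
    · intro h
      have hprop : a ≤ q ∧ 0 < q ∧ q ≤ Q ∧ a.Coprime q := by
        rcases h with h | ⟨rfl, rfl⟩ | ⟨rfl, rfl⟩
        · exact ⟨by omega, by omega, by omega, h.2⟩
        · exact ⟨by omega, by omega, hQ, by simp⟩
        · exact ⟨by omega, by omega, hQ, by simp⟩
      obtain ⟨h1, h2, h3, h4⟩ := hprop
      have hc : IsCoprime (a : ℤ) q := Nat.isCoprime_iff_coprime.2 h4
      have hn := num_den_of_isCoprime (by exact_mod_cast h2) hc
      refine ⟨_, mem_fareySet_div (Nat.cast_nonneg a) (by exact_mod_cast h1)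
        (by exact_mod_cast h2) (by exact_mod_cast h3) hc, ?_, ?_⟩
      · rw [hn.1]
        simp
      · exact_mod_cast hn.2
  rw [← hinj.ncard_image, himg, Set.ncard_coe_finset, Finset.card_union_of_disjoint]
  · rfl
  · rw [Finset.disjoint_left]
    rintro p hp h
    rw [hmem] at hp
    simp only [Finset.mem_insert, Finset.mem_singleton] at h
    rcases h with rfl | rfl <;> simp at hp

theorem tendsto_fareyProportion {r d c : ℕ} (hr : 5 ≤ r) (hd : 2 ≤ d) (hcd : c.Coprime d) :
    Tendsto (fun Q : ℕ => fareyProportion Q (fun _ : Fin r => c) d) atTop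
      (𝓝 (1 / ((d : ℝ) ^ 2 * (2 * (r : ℝ) - 3)) *
        ∏ p ∈ d.primeFactors, (1 - 1 / (p : ℝ) ^ 2)⁻¹)) := by
  have : NeZero d := ⟨by omega⟩
  have hnum := ((wedgeShape_progression hr hd).tendsto_card_wedge_coprime (by omega : 0 < d)
    hcd).const_mul 2
  have hden := wedgeShape_farey.tendsto_card_wedge_coprime one_pos (Nat.coprime_one_right 1)
  -- The two endpoints and the correction `r - 1` in the denominator are negligible against `Q²`.
  have hconst : Tendsto (fun Q : ℕ => (2 - ((r : ℝ) - 1)) / (Q : ℝ) ^ 2) atTop (𝓝 0) :=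
    (tendsto_const_nhds (x := 2 - ((r : ℝ) - 1))).div_atTop
      ((tendsto_pow_atTop two_ne_zero).comp tendsto_natCast_atTop_atTop)
  have hlim := hnum.div (hden.add hconst) (by simpa using moebiusSum_one_ne_zero)
  have hval : 2 * ((1 - 1 / 2) ^ 2 / (2 * (((r - 1 : ℕ) : ℝ) * d - (d : ℝ) / 2) * d) *
      moebiusSum d) / ((1 - 0) ^ 2 / (2 * (0 - -1) * ((1 : ℕ) : ℝ)) * moebiusSum 1 + 0) =
      1 / ((d : ℝ) ^ 2 * (2 * (r : ℝ) - 3)) * ∏ p ∈ d.primeFactors, (1 - 1 / (p : ℝ) ^ 2)⁻¹ := by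
    rw [← moebiusSum_div_moebiusSum_one]
    have hr' : (5 : ℝ) ≤ r := by exact_mod_cast hr
    have h3 : 2 * (r : ℝ) - 3 ≠ 0 := by linarith
    have hd' : (d : ℝ) ≠ 0 := by exact_mod_cast (by omega : d ≠ 0)
    have h1 := moebiusSum_one_ne_zero
    rw [Nat.cast_sub (by omega), Nat.cast_one,
      show ((r : ℝ) - 1) * d - (d : ℝ) / 2 = (2 * (r : ℝ) - 3) * d / 2 by ring]
    field_simp
    norm_num
    field_simp
  rw [← hval]
  refine hlim.congr' ?_
  filter_upwards [eventually_ge_atTop 2] with Q hQ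
  have hQ' : (Q : ℝ) ^ 2 ≠ 0 := pow_ne_zero 2 (by exact_mod_cast (by omega : Q ≠ 0))
  rw [fareyProportion, ncard_fareyTuples hQ hr hd hcd, ncard_fareySet (by omega)]
  simp only [Pi.div_apply]
  rw [← add_div, mul_div_assoc', div_div_div_cancel_right₀ hQ', progressionPoints]
  push_cast
  congr 1
  ring

theorem corollary3 :
    (∀ r d c : ℕ, 5 ≤ r → 2 ≤ d → c ≤ d - 1 → Nat.Coprime c d →
      Tendsto (fun Q : ℕ => fareyProportion Q (fun _ : Fin r => c) d) atTop
        (𝓝 (1 / ((d : ℝ) ^ 2 * (2 * (r : ℝ) - 3)) *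
          ∏ p ∈ d.primeFactors, (1 - 1 / (p : ℝ) ^ 2)⁻¹))) ∧
    (∀ r : ℕ, 5 ≤ r →
      Tendsto (fun Q : ℕ => fareyProportion Q (fun _ : Fin r => 1) 2) atTop
        (𝓝 (1 / (3 * (2 * (r : ℝ) - 3))))) := by
  refine ⟨fun r d c hr hd _ hcd => tendsto_fareyProportion hr hd hcd, fun r hr => ?_⟩
  have h := tendsto_fareyProportion hr le_rfl (Nat.coprime_one_left 2)
  convert! h using 2
  rw [Nat.prime_two.primeFactors, Finset.prod_singleton]
  have hr' : (5 : ℝ) ≤ r := by exact_mod_cast hr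
  have h3 : 2 * (r : ℝ) - 3 ≠ 0 := by linarith
  push_cast
  field_simp
  norm_num
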